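/- Let $E$ be a real Banach space with (norm) dual $E^*$ and duality pairing $\langle x,x^*\rangle = x^*(x)$. Let $S\colon E\rightrightarrows E^*$ be a multifunction, i.e. a map assigning to each $x\in E$ a subset $S(x)\subset E^*$; write $G(S)=\{(x,x^*)\in E\times E^*: x^*\in S(x)\}$ for its graph and $D(S)=\{x\in E: S(x)\neq\emptyset\}$ for its domain. Suppose that * $S$ is closed, i.e. $G(S)$ is a norm-closed subset of $E\times E^*$; * $S$ is monotone, i.e. $\langle s-t,s^*-t^*\rangle\ge 0$ for all $(s,s^*),(t,t^*)\in G(S)$; * $S$ is quasidense, i.e. for all $(x,x^*)\in E\times E^*$, $$\inf_{(s,s^*)\in G(S)}\Big[\tfrac12\|s-x\|^2+\tfrac12\|s^*-x^*\|^2+\langle s-x,s^*-x^*\rangle\Big]\le 0$$ (with $\inf\emptyset=+\infty$, so that $G(S)\ne\emptyset$). Then $S$ is maximally monotone (no monotone multifunction $E\rightrightarrows E^*$ has a graph properly containing $G(S)$) and of type (FPV): whenever $U$ is an open convex subset of $E$ with $U\cap D(S)\ne\emptyset$, and $(w,w^*)\in U\times E^*$ is such that $$(s,s^*)\in G(S)\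 \text{ and }\ s\in U\ \Longrightarrow\ \langle s-w,s^*-w^*\rangle\ge 0,$$ then $(w,w^*)\in G(S)$. -/

import Mathlib

/-- A multifunction `E ⇉ E*` from a real normed space into its (norm) dual. -/
abbrev Multifunction (E : Type*) [NormedAddCommGroup E] [NormedSpace ℝ E] : Type _ :=
  E → Set (StrongDual ℝ E)

namespace Multifunction

variable {E : Type*} [NormedAddCommGroup E] [NormedSpace ℝ E]

/-- The graph `G(S)`. -/
def graph (S : Multifunction E) : Set (E × StrongDual ℝ E) :=
  {p | p.2 ∈ S p.1}

/-- The domain `D(S)`. -/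
def domain (S : Multifunction E) : Set E :=
  {x | (S x).Nonempty}

/-- `S` is closed: its graph is closed for the norm topology of `E × E*`. -/
def Closed (S : Multifunction E) : Prop :=
  IsClosed S.graph

/-- `S` is monotone: `⟨s - t, s* - t*⟩ ≥ 0` for all `(s, s*)`, `(t, t*)` in `G(S)`. -/
def IsMonotone (S : Multifunction E) : Prop :=
  ∀ p ∈ S.graph, ∀ q ∈ S.graph, 0 ≤ (p.2 - q.2) (p.1 - q.1)

/-- `S` is maximally monotone: it is monotone, and a monotone multifunction whose graph
contains `G(S)` is equal to `S`. -/
def IsMaximallyMonotone (S : Multifunction E) : Prop :=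
  S.IsMonotone ∧ ∀ T : Multifunction E, T.IsMonotone → S.graph ⊆ T.graph → T = S

/-- `S` is quasidense. The infimum is taken in the extended reals, so that the infimum over
an empty graph is `+∞`. -/
def Quasidense (S : Multifunction E) : Prop :=
  ∀ (x : E) (x' : StrongDual ℝ E),
    (⨅ p ∈ S.graph,
      ((1 / 2 * ‖p.1 - x‖ ^ 2 + 1 / 2 * ‖p.2 - x'‖ ^ 2 + (p.2 - x') (p.1 - x) : ℝ) : EReal)) ≤ 0

/-- `S` is of type (FPV), or maximally monotone locally. -/
def IsTypeFPV (S : Multifunction E) : Prop :=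
  S.IsMonotone ∧
    ∀ U : Set E, IsOpen U → Convex ℝ U → (U ∩ S.domain).Nonempty →
      ∀ w ∈ U, ∀ w' : StrongDual ℝ E,
        (∀ p ∈ S.graph, p.1 ∈ U → 0 ≤ (p.2 - w') (p.1 - w)) → (w, w') ∈ S.graph

end Multifunction

open Metric Set

namespace Multifunction

variable {E : Type*} [NormedAddCommGroup E] [NormedSpace ℝ E]

/-! Translate so that the point to be caught is the origin, and let `C` be a bounded open convex
neighbourhood in `U` of the segment from it to a domain point. Let `φ` be the Fitzpatrick function
of `G` and `f` half the squared norm on `C`. Separating the epigraph of `φ` from the hypograph of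
`-f - f*(-·)`, raised by `ε`, shows that `φ + f + f*(-·)` has infimum at most zero
(`exists_fitzpatrick_add_conjugate_le`). At a near-minimizer `(x, y)`, quasidensity puts a point of
`G` nearby (`exists_near`), over `U`, so `y x` is almost nonnegative. As `φ` majorizes the pairing,
`f x + f*(-y)` is small, which forces `x` and `y` to be small. Closedness concludes. -/

/-- The epigraph of the Fitzpatrick function of a subset `G` of `E × E*`. -/
def fitzpatrickEpigraph (G : Set (E × StrongDual ℝ E)) : Set (E × StrongDual ℝ E × ℝ) :=
  {z | ∀ p ∈ G, p.2 z.1 + z.2.1 p.1 - p.2 p.1 ≤ z.2.2}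

/-- Quasidensity of a subset of `E × E*`, in terms of approximate minimizers. -/
def QuasidenseSet (G : Set (E × StrongDual ℝ E)) : Prop :=
  ∀ (x : E) (x' : StrongDual ℝ E) (ε : ℝ), 0 < ε → ∃ p ∈ G,
    1 / 2 * ‖p.1 - x‖ ^ 2 + 1 / 2 * ‖p.2 - x'‖ ^ 2 + (p.2 - x') (p.1 - x) < ε

/-- Monotonicity of a subset of `E × E*`. -/
def MonotoneSet (G : Set (E × StrongDual ℝ E)) : Prop :=
  ∀ p ∈ G, ∀ q ∈ G, 0 ≤ (p.2 - q.2) (p.1 - q.1)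

/-! ### Quasidensity and its dual form -/

theorem Quasidense.quasidenseSet {S : Multifunction E} (h : S.Quasidense) :
    QuasidenseSet S.graph := by
  intro x x' ε hε
  have h0 := (h x x').trans_lt (EReal.coe_pos.2 hε)
  simp only [iInf_lt_iff] at h0
  obtain ⟨p, hp, hlt⟩ := h0
  exact ⟨p, hp, EReal.coe_lt_coe_iff.1 hlt⟩

/-- A functional on a normed space nearly attains minus the square of its norm on the ball whose
radius is its norm. -/
theorem exists_apply_le_neg_sq_norm {F : Type*} [NormedAddCommGroup F] [NormedSpace ℝ F]
    (f : StrongDual ℝ F) {ε : ℝ} (hε : 0 < ε) :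
    ∃ u : F, ‖u‖ ≤ ‖f‖ ∧ f u ≤ -‖f‖ ^ 2 + ε := by
  rcases (norm_nonneg f).eq_or_lt with h | h
  · exact ⟨0, by simp, by simp [← h, hε.le]⟩
  obtain ⟨x, hx, hlt⟩ := f.exists_lt_apply_of_lt_opNorm (r := ‖f‖ - ε / ‖f‖)
    (by have := div_pos hε h; linarith)
  have key : ‖f‖ ^ 2 - ε ≤ ‖f‖ * |f x| := by
    have := mul_le_mul_of_nonneg_left hlt.le h.le
    rw [Real.norm_eq_abs, mul_sub, mul_div_cancel₀ _ h.ne'] at this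
    linarith [sq ‖f‖]
  have hn : ‖f‖ * ‖x‖ ≤ ‖f‖ := by nlinarith
  rcases abs_cases (f x) with ⟨hc, -⟩ | ⟨hc, -⟩ <;> rw [hc] at key
  · refine ⟨-(‖f‖ • x), by simpa [norm_smul] using hn, ?_⟩
    simp only [map_neg, map_smul, smul_eq_mul]
    linarith
  · refine ⟨‖f‖ • x, by simpa [norm_smul] using hn, ?_⟩
    simp only [map_smul, smul_eq_mul]
    linarith

/-- A quasidense set has negative infimum with respect to every point of `E* × E**`. -/
theorem QuasidenseSet.negative_infimum {G : Set (E × StrongDual ℝ E)} (hG : QuasidenseSet G)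
    (z : StrongDual ℝ E) (Z : StrongDual ℝ (StrongDual ℝ E)) {ε : ℝ} (hε : 0 < ε) :
    ∃ p ∈ G, p.2 p.1 - z p.1 - Z p.2 + Z z ≤ ε := by
  obtain ⟨u, hu, hZu⟩ := exists_apply_le_neg_sq_norm Z (half_pos hε)
  -- The shift by `u` leaves only the negatives of half the squares of `‖p.1‖ - ‖Z‖` and `‖v‖ -
  -- ‖Z‖`, up to `ε`.
  obtain ⟨p, hp, hlt⟩ := hG 0 (z - u) (ε / 2) (half_pos hε)
  refine ⟨p, hp, ?_⟩
  set v := p.2 - (z - u) with hv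
  have hp2 : p.2 = v + z - u := by rw [hv]; abel
  have h1 : -Z v ≤ ‖Z‖ * ‖v‖ := (neg_le_abs _).trans (Z.le_opNorm v)
  have h2 : -u p.1 ≤ ‖Z‖ * ‖p.1‖ :=
    ((neg_le_abs _).trans (u.le_opNorm p.1)).trans
      (mul_le_mul_of_nonneg_right hu (norm_nonneg _))
  rw [sub_zero] at hlt
  have e1 : p.2 p.1 = v p.1 + z p.1 - u p.1 := by rw [hp2]; simp
  have e2 : Z p.2 = Z v + Z z - Z u := by rw [hp2]; simp
  rw [e1, e2]
  nlinarith [sq_nonneg (‖p.1‖ - ‖Z‖), sq_nonneg (‖v‖ - ‖Z‖)]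

/-! ### The two convex sets and their separation -/

theorem convex_fitzpatrickEpigraph (G : Set (E × StrongDual ℝ E)) :
    Convex ℝ (fitzpatrickEpigraph G) := by
  intro z hz y hy a b ha hb hab p hp
  have h1 := mul_le_mul_of_nonneg_left (hz p hp) ha
  have h2 := mul_le_mul_of_nonneg_left (hy p hp) hb
  simp only [Prod.fst_add, Prod.snd_add, Prod.smul_fst, Prod.smul_snd, map_add, map_smul,
    smul_eq_mul, add_apply, smul_apply]
  have h3 : p.2 p.1 = a * p.2 p.1 + b * p.2 p.1 := by rw [← add_mul, hab, one_mul]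
  linarith

theorem MonotoneSet.mem_fitzpatrickEpigraph {G : Set (E × StrongDual ℝ E)} (hG : MonotoneSet G)
    {p : E × StrongDual ℝ E} (hp : p ∈ G) : (p.1, p.2, p.2 p.1) ∈ fitzpatrickEpigraph G := by
  intro q hq
  have := hG p hp q hq
  simp only [sub_apply, map_sub] at this
  dsimp only
  linarith

/-- The hypograph of `(x, y) ↦ ε - f x - f* (-y)`, where `f` is half the squared norm on `C` and
`+∞` off `C`. -/
def conjugateHypograph (C : Set E) (ε : ℝ) : Set (E × StrongDual ℝ E × ℝ) :=
  {z | z.1 ∈ C ∧ ∃ k : ℝ, (∀ c ∈ C, -z.2.1 c - 1 / 2 * ‖c‖ ^ 2 ≤ k) ∧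
    z.2.2 < ε - 1 / 2 * ‖z.1‖ ^ 2 - k}

theorem convex_conjugateHypograph {C : Set E} (hC : Convex ℝ C) (ε : ℝ) :
    Convex ℝ (conjugateHypograph C ε) := by
  rintro z ⟨hz, k, hk, hzk⟩ y ⟨hy, l, hl, hyl⟩ a b ha hb hab
  refine ⟨hC hz hy ha hb hab, a * k + b * l, fun c hc => ?_, ?_⟩
  · have h1 := mul_le_mul_of_nonneg_left (hk c hc) ha
    have h2 := mul_le_mul_of_nonneg_left (hl c hc) hb
    simp only [Prod.fst_add, Prod.snd_add, Prod.smul_fst, Prod.smul_snd,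
      smul_eq_mul, add_apply, smul_apply]
    have h3 : ‖c‖ ^ 2 = a * ‖c‖ ^ 2 + b * ‖c‖ ^ 2 := by rw [← add_mul, hab, one_mul]
    linarith
  · have hcvx : ‖a • z.1 + b • y.1‖ ^ 2 ≤ a * ‖z.1‖ ^ 2 + b * ‖y.1‖ ^ 2 :=
      (((convexOn_norm (convex_univ (E := E))).pow (fun _ _ => norm_nonneg _) 2).2
        (mem_univ z.1) (mem_univ y.1) ha hb hab)
    have h3 : ε = a * ε + b * ε := by rw [← add_mul, hab, one_mul]
    simp only [Prod.fst_add, Prod.snd_add, Prod.smul_fst, Prod.smul_snd, smul_eq_mul]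
    have hmix : a * z.2.2 + b * y.2.2 <
        a * (ε - 1 / 2 * ‖z.1‖ ^ 2 - k) + b * (ε - 1 / 2 * ‖y.1‖ ^ 2 - l) := by
      rcases ha.eq_or_lt with rfl | ha'
      · have hb1 : b = 1 := by linarith
        subst hb1
        linarith
      · have := mul_lt_mul_of_pos_left hzk ha'
        have := mul_le_mul_of_nonneg_left hyl.le hb
        linarith
    linarith

/-- Boundedness of `C` makes the conjugate `M`-Lipschitz, so a bound `k` at one functional yields a
bound at its neighbours. -/
theorem isOpen_conjugateHypograph {C : Set E} (hC : IsOpen C) {M : ℝ}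
    (hM : ∀ c ∈ C, ‖c‖ ≤ M) (ε : ℝ) : IsOpen (conjugateHypograph C ε) := by
  rw [isOpen_iff_mem_nhds]
  rintro z ⟨hz, k, hk, hzk⟩
  have hcont : Continuous fun y : E × StrongDual ℝ E × ℝ =>
      ε - 1 / 2 * ‖y.1‖ ^ 2 - (k + M * ‖y.2.1 - z.2.1‖) := by fun_prop
  have hopen : IsOpen {y : E × StrongDual ℝ E × ℝ | y.1 ∈ C ∧
      y.2.2 < ε - 1 / 2 * ‖y.1‖ ^ 2 - (k + M * ‖y.2.1 - z.2.1‖)} :=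
    (hC.preimage continuous_fst).inter (isOpen_lt (continuous_snd.comp continuous_snd) hcont)
  filter_upwards [hopen.mem_nhds ⟨hz, by simpa using hzk⟩]
  rintro y ⟨hy, hlt⟩
  refine ⟨hy, _, fun c hc => ?_, hlt⟩
  have h1 : -(y.2.1 - z.2.1) c ≤ ‖y.2.1 - z.2.1‖ * ‖c‖ :=
    (neg_le_abs _).trans ((y.2.1 - z.2.1).le_opNorm c)
  have h2 := mul_le_mul_of_nonneg_left (hM c hc) (norm_nonneg (y.2.1 - z.2.1))
  have h3 := hk c hc
  rw [sub_apply] at h1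
  linarith

/-- The function `-y c - ‖c‖ ^ 2 / 2` is bounded above on a bounded set `C`. -/
theorem neg_apply_sub_le {C : Set E} {M : ℝ} (hM : ∀ c ∈ C, ‖c‖ ≤ M) (y : StrongDual ℝ E)
    {c : E} (hc : c ∈ C) : -y c - 1 / 2 * ‖c‖ ^ 2 ≤ ‖y‖ * M := by
  have h1 : -y c ≤ ‖y‖ * ‖c‖ := (neg_le_abs _).trans (y.le_opNorm c)
  have h2 := mul_le_mul_of_nonneg_left (hM c hc) (norm_nonneg y)
  have := sq_nonneg ‖c‖
  linarith

/-- With `φ` the Fitzpatrick function of `G` and `f` half the squared norm on `C` (and `+∞` off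
`C`), the infimum of `φ (x, y) + f x + f* (-y)` is at most `0`. -/
theorem exists_fitzpatrick_add_conjugate_le {G : Set (E × StrongDual ℝ E)}
    (hmono : MonotoneSet G) (hqd : QuasidenseSet G) {C : Set E} (hCo : IsOpen C)
    (hCc : Convex ℝ C) {M : ℝ} (hM : ∀ c ∈ C, ‖c‖ ≤ M)
    {a : E × StrongDual ℝ E} (ha : a ∈ G) (haC : a.1 ∈ C) {ε : ℝ} (hε : 0 < ε) :
    ∃ (x : E) (y : StrongDual ℝ E) (t k : ℝ), x ∈ C ∧ (x, y, t) ∈ fitzpatrickEpigraph G ∧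
      (∀ c ∈ C, -y c - 1 / 2 * ‖c‖ ^ 2 ≤ k) ∧ t + 1 / 2 * ‖x‖ ^ 2 + k < ε := by
  by_contra! hcon
  have hdisj : Disjoint (conjugateHypograph C ε) (fitzpatrickEpigraph G) := by
    rw [Set.disjoint_left]
    rintro ⟨x, y, t⟩ ⟨hx, k, hk, hlt⟩ hA
    have := hcon x y t k hx hA hk
    dsimp only at hlt
    linarith
  obtain ⟨F, u, hB, hA⟩ := geometric_hahn_banach_open (convex_conjugateHypograph hCc ε)
    (isOpen_conjugateHypograph hCo hM ε) (convex_fitzpatrickEpigraph G) hdisj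
  set F₁ : StrongDual ℝ E := F.comp (ContinuousLinearMap.inl ℝ E (StrongDual ℝ E × ℝ)) with hF₁
  set F₂ : StrongDual ℝ (StrongDual ℝ E) := (F.comp (ContinuousLinearMap.inr ℝ E
    (StrongDual ℝ E × ℝ))).comp (ContinuousLinearMap.inl ℝ (StrongDual ℝ E) ℝ) with hF₂
  set d : ℝ := F (0, 0, 1) with hd
  have hF : ∀ x y t, F (x, y, t) = F₁ x + F₂ y + t * d := by
    intro x y t
    have : ((x, y, t) : E × StrongDual ℝ E × ℝ) = (x, 0, 0) + (0, y, 0) + t • (0, 0, 1) := by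
      simp
    rw [this, map_add, map_add, map_smul]
    simp [hF₁, hF₂, hd, ← Prod.mk_zero_zero]
  -- Both sets have a point over `a`, the hypograph's strictly lower, so the hyperplane is not
  -- vertical.
  have hdpos : 0 < d := by
    set b := min (a.2 a.1) (ε - 1 / 2 * ‖a.1‖ ^ 2 - ‖a.2‖ * M) - 1 with hb
    have hb1 : b < a.2 a.1 := by
      linarith [min_le_left (a.2 a.1) (ε - 1 / 2 * ‖a.1‖ ^ 2 - ‖a.2‖ * M)]
    have h1 := hB (a.1, a.2, b) ⟨haC, ‖a.2‖ * M, fun c hc => neg_apply_sub_le hM a.2 hc, by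
      dsimp only
      linarith [min_le_right (a.2 a.1) (ε - 1 / 2 * ‖a.1‖ ^ 2 - ‖a.2‖ * M)]⟩
    have h2 := hA _ (hmono.mem_fitzpatrickEpigraph ha)
    rw [hF] at h1 h2
    by_contra! hd0
    nlinarith
  set z : StrongDual ℝ E := -(d⁻¹ • F₁) with hz
  set Z : StrongDual ℝ (StrongDual ℝ E) := -(d⁻¹ • F₂) with hZ
  have hF' : ∀ x y t, F (x, y, t) = d * (t - z x - Z y) := by
    intro x y t
    rw [hF]
    simp only [hz, hZ, neg_apply, smul_apply, smul_eq_mul]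
    field_simp
    ring
  obtain ⟨p, hp, hple⟩ := hqd.negative_infimum z Z (ε := ε / 4) (by linarith)
  set D : Set ℝ := (fun c => -z c - 1 / 2 * ‖c‖ ^ 2) '' C with hD
  have hDne : D.Nonempty := ⟨_, a.1, haC, rfl⟩
  have hDbdd : BddAbove D := by
    refine ⟨‖z‖ * M, ?_⟩
    rintro _ ⟨c, hc, rfl⟩
    exact neg_apply_sub_le hM z hc
  obtain ⟨_, ⟨x, hx, rfl⟩, hxlt⟩ :=
    exists_lt_of_lt_csSup hDne (show sSup D - ε / 4 < sSup D by linarith)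
  -- With second coordinate `z`, the term `Z z` occurs on both sides and cancels, leaving `ε / 2 < ε
  -- / 4`.
  have h1 := hB (x, z, ε - 1 / 2 * ‖x‖ ^ 2 - sSup D - ε / 4)
    ⟨hx, sSup D, fun c hc => le_csSup hDbdd ⟨c, hc, rfl⟩, by dsimp only; linarith⟩
  have h2 := h1.trans_le (hA _ (hmono.mem_fitzpatrickEpigraph hp))
  rw [hF', hF', mul_lt_mul_iff_right₀ hdpos] at h2
  dsimp only at hxlt
  linarith

/-! ### From near-minimizers to points of the set -/

/-- If `φ (x, y) ≤ y x + ε`, with `φ` the Fitzpatrick function of the quasidense set `G`, then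
`(x, y)` is near `G`. -/
theorem QuasidenseSet.exists_near {G : Set (E × StrongDual ℝ E)} (hqd : QuasidenseSet G)
    {x : E} {y : StrongDual ℝ E} {t δ : ℝ} (hδ : 0 < δ)
    (hxy : (x, y, t) ∈ fitzpatrickEpigraph G) (ht : t ≤ y x + δ ^ 2 / 4) :
    ∃ p ∈ G, ‖p.1 - x‖ ≤ δ ∧ ‖p.2 - y‖ ≤ δ := by
  obtain ⟨p, hp, hlt⟩ := hqd x y (δ ^ 2 / 4) (by positivity)
  have h := hxy p hp
  dsimp only at h
  have e : (p.2 - y) (p.1 - x) = p.2 p.1 - p.2 x - (y p.1 - y x) := by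
    simp only [map_sub, sub_apply]
    ring
  rw [e] at hlt
  have h1 := sq_nonneg ‖p.1 - x‖
  have h2 := sq_nonneg ‖p.2 - y‖
  exact ⟨p, hp, abs_le_of_sq_le_sq' (by linarith) hδ.le |>.2,
    abs_le_of_sq_le_sq' (by linarith) hδ.le |>.2⟩

/-- The Fitzpatrick function of a quasidense set majorizes the duality pairing. -/
theorem QuasidenseSet.apply_le {G : Set (E × StrongDual ℝ E)} (hqd : QuasidenseSet G)
    {x : E} {y : StrongDual ℝ E} {t : ℝ} (hxy : (x, y, t) ∈ fitzpatrickEpigraph G) :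
    y x ≤ t := by
  refine le_of_forall_pos_le_add fun ε hε => ?_
  obtain ⟨p, hp, hlt⟩ := hqd x y ε hε
  have h := hxy p hp
  dsimp only at h
  simp only [map_sub, sub_apply] at hlt
  have h1 := sq_nonneg ‖p.1 - x‖
  have h2 := sq_nonneg ‖p.2 - y‖
  linarith

/-- If half the squared norm on a set containing the closed ball of radius `ρ` has conjugate at
most `k` at `-y`, then `ρ * ‖y‖ ≤ k + ρ ^ 2 / 2`. -/
theorem mul_norm_le_of_conjugate_le {C : Set E} {ρ k : ℝ} (hρ : 0 < ρ)
    (hC : closedBall 0 ρ ⊆ C) {y : StrongDual ℝ E}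
    (hk : ∀ c ∈ C, -y c - 1 / 2 * ‖c‖ ^ 2 ≤ k) : ρ * ‖y‖ ≤ k + ρ ^ 2 / 2 := by
  have hb : ∀ b : E, ‖b‖ ≤ ρ → -y b ≤ k + ρ ^ 2 / 2 := by
    intro b hb
    have h1 := hk b (hC (by simpa using hb))
    have h2 : ‖b‖ ^ 2 ≤ ρ ^ 2 := pow_le_pow_left₀ (norm_nonneg b) hb 2
    linarith
  refine le_of_forall_pos_le_add fun ε hε => ?_
  rcases (norm_nonneg y).eq_or_lt with h | h
  · have := hb 0 (by simpa using hρ.le)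
    rw [map_zero, neg_zero] at this
    rw [← h, mul_zero]
    linarith
  obtain ⟨u, hu, hyu⟩ := exists_apply_le_neg_sq_norm y (ε := ε * ‖y‖ / ρ) (by positivity)
  have h1 := hb ((ρ / ‖y‖) • u) (by
    rw [norm_smul, Real.norm_of_nonneg (by positivity), div_mul_eq_mul_div, div_le_iff₀ h]
    exact mul_le_mul_of_nonneg_left hu hρ.le)
  rw [map_smul, smul_eq_mul] at h1
  have h2 : ρ / ‖y‖ * y u ≤ ρ / ‖y‖ * (-‖y‖ ^ 2 + ε * ‖y‖ / ρ) :=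
    mul_le_mul_of_nonneg_left hyu (by positivity)
  have h3 : ρ / ‖y‖ * (-‖y‖ ^ 2 + ε * ‖y‖ / ρ) = -(ρ * ‖y‖) + ε := by
    field_simp
  linarith

/-- A closed monotone quasidense set contains `(0, 0)` whenever the duality pairing is nonnegative
on the part of the set that lies over an open convex set `U` containing `0` and meeting the
domain. -/
theorem zero_mem_of_nonneg_on {G : Set (E × StrongDual ℝ E)} (hcl : IsClosed G)
    (hmono : MonotoneSet G) (hqd : QuasidenseSet G) {U : Set E} (hUo : IsOpen U)
    (hUc : Convex ℝ U) (h0 : (0 : E) ∈ U) {a : E × StrongDual ℝ E} (ha : a ∈ G) (haU : a.1 ∈ U)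
    (hnonneg : ∀ p ∈ G, p.1 ∈ U → 0 ≤ p.2 p.1) :
    ((0 : E), (0 : StrongDual ℝ E)) ∈ G := by
  have hcomp : IsCompact (segment ℝ (0 : E) a.1) := by
    rw [segment_eq_image ℝ (0 : E) a.1]
    exact isCompact_Icc.image (by fun_prop)
  obtain ⟨R, hR, hRU⟩ := hcomp.exists_thickening_subset_open hUo (hUc.segment_subset h0 haU)
  -- Half the available radius leaves room for points of `G` close to `C` to lie over `U`.
  set C : Set E := thickening (R / 2) (segment ℝ (0 : E) a.1) with hC
  have hCo : IsOpen C := isOpen_thickening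
  have hCc : Convex ℝ C := (convex_segment _ _).thickening _
  have haC : a.1 ∈ C := self_subset_thickening (by positivity) _ (right_mem_segment _ _ _)
  have hCU : ∀ x ∈ C, ∀ s : E, ‖s - x‖ < R / 2 → s ∈ U := by
    intro x hx s hs
    obtain ⟨b, hb, hxb⟩ := mem_thickening_iff.1 hx
    refine hRU (mem_thickening_iff.2 ⟨b, hb, ?_⟩)
    have := dist_triangle s x b
    rw [dist_eq_norm s x] at this
    linarith
  obtain ⟨M, hM⟩ : ∃ M : ℝ, ∀ c ∈ C, ‖c‖ ≤ M :=
    (hcomp.isBounded.thickening (δ := R / 2)).exists_norm_le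
  have hM0 : 0 ≤ M := (norm_nonneg _).trans (hM _ haC)
  rw [← hcl.closure_eq, Metric.mem_closure_iff]
  intro η hη
  set ρ : ℝ := min (R / 4) (η / 4) with hρdef
  have hρ : 0 < ρ := lt_min (by positivity) (by positivity)
  have hρR : ρ ≤ R / 4 := min_le_left _ _
  have hρη : ρ ≤ η / 4 := min_le_right _ _
  have hball : closedBall 0 ρ ⊆ C := by
    intro b hb
    refine mem_thickening_iff.2 ⟨0, left_mem_segment _ _ _, ?_⟩
    have := mem_closedBall.1 hb
    linarith
  -- These bounds will give `‖x‖, ‖y‖ ≤ 2 * ρ`, so the nearby point of `G` has norm at most `5 * ρ /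
  -- 2 < η`.
  obtain ⟨δ, hδ, hδ1, hδρ, hδM⟩ :
      ∃ δ : ℝ, 0 < δ ∧ δ ≤ 1 ∧ δ ≤ ρ / 2 ∧ δ * (M + 2) ≤ ρ ^ 2 / 2 := by
    refine ⟨min (min 1 (ρ / 2)) (ρ ^ 2 / 2 / (M + 2)), by positivity,
      (min_le_left _ _).trans (min_le_left _ _), (min_le_left _ _).trans (min_le_right _ _), ?_⟩
    rw [← le_div_iff₀ (by positivity)]
    exact min_le_right _ _
  obtain ⟨x, y, t, k, hxC, hxy, hk, hlt⟩ := exists_fitzpatrick_add_conjugate_le hmono hqd hCo hCc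
    hM ha haC (ε := δ ^ 2 / 4) (by positivity)
  -- Fenchel–Young: `hk` at `x` bounds `-(y x)` by `‖x‖ ^ 2 / 2 + k`.
  obtain ⟨p, hp, hp1, hp2⟩ := hqd.exists_near hδ hxy (by linarith [hk x hxC])
  have hpos : 0 ≤ p.2 p.1 := hnonneg p hp (hCU x hxC _ (by linarith))
  have hpair : -(y x) ≤ δ * ‖y‖ + δ * (‖x‖ + δ) := by
    have e : -(y x) = y (p.1 - x) + (p.2 - y) p.1 - p.2 p.1 := by
      simp only [map_sub, sub_apply]
      ring
    have h1 : y (p.1 - x) ≤ ‖y‖ * δ := (le_abs_self _).trans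
      ((y.le_opNorm _).trans (mul_le_mul_of_nonneg_left hp1 (norm_nonneg _)))
    have hp1' : ‖p.1‖ ≤ ‖x‖ + δ := by
      have := norm_add_le x (p.1 - x)
      rw [add_sub_cancel] at this
      linarith
    have h2 : (p.2 - y) p.1 ≤ δ * (‖x‖ + δ) := (le_abs_self _).trans
      (((p.2 - y).le_opNorm _).trans (mul_le_mul hp2 hp1' (norm_nonneg _) hδ.le))
    linarith
  have hyt := hqd.apply_le hxy
  have hky := mul_norm_le_of_conjugate_le hρ hball hk
  have hk0 : 0 ≤ k := by simpa using hk 0 (hball (by simpa using hρ.le))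
  have hxM := mul_le_mul_of_nonneg_left (hM x hxC) hδ.le
  have hδδ : δ ^ 2 ≤ δ := by nlinarith
  have hsum : 1 / 2 * ‖x‖ ^ 2 + k ≤ δ * ‖y‖ + δ * (M + 2) := by nlinarith
  have hY : ‖y‖ ≤ 2 * ρ := by
    have h1 : δ * ‖y‖ ≤ ρ / 2 * ‖y‖ := mul_le_mul_of_nonneg_right hδρ (norm_nonneg _)
    have h2 := sq_nonneg ‖x‖
    have h3 : ρ * ‖y‖ ≤ ρ * (2 * ρ) := by nlinarith
    exact le_of_mul_le_mul_left h3 hρ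
  have hX : ‖x‖ ≤ 2 * ρ := by
    have h1 : δ * ‖y‖ ≤ ρ / 2 * (2 * ρ) := mul_le_mul hδρ hY (norm_nonneg _) (by positivity)
    exact (abs_le_of_sq_le_sq' (by nlinarith) (by positivity)).2
  refine ⟨p, hp, ?_⟩
  rw [dist_comm, dist_eq_norm, Prod.mk_zero_zero, sub_zero, Prod.norm_def, max_lt_iff]
  constructor
  · have := norm_add_le x (p.1 - x)
    rw [add_sub_cancel] at this
    linarith
  · have := norm_add_le y (p.2 - y)
    rw [add_sub_cancel] at this
    linarith

/-- A closed monotone quasidense multifunction is of type (FPV). -/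
theorem Quasidense.isTypeFPV {S : Multifunction E} (hqd : S.Quasidense) (hclosed : S.Closed)
    (hmono : S.IsMonotone) : S.IsTypeFPV := by
  refine ⟨hmono, ?_⟩
  rintro U hUo hUc ⟨a, haU, a', ha'⟩ w hw w' hrel
  -- All hypotheses are invariant under translation by `(w, w')`.
  set G : Set (E × StrongDual ℝ E) := (fun p => p + (w, w')) ⁻¹' S.graph with hG
  have hmem : ∀ p ∈ S.graph, p - (w, w') ∈ G := fun p hp => by simpa [hG] using hp
  have hGcl : IsClosed G := hclosed.preimage (by fun_prop)
  have hGmono : MonotoneSet G := by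
    intro p hp q hq
    simpa using hmono _ hp _ hq
  have hGqd : QuasidenseSet G := by
    intro x x' ε hε
    obtain ⟨p, hp, hlt⟩ := hqd.quasidenseSet (x + w) (x' + w') ε hε
    refine ⟨p - (w, w'), hmem p hp, ?_⟩
    rwa [Prod.fst_sub, Prod.snd_sub, sub_sub, sub_sub, add_comm w x, add_comm w' x']
  have hzero := zero_mem_of_nonneg_on hGcl hGmono hGqd
    (U := (fun x => x + w) ⁻¹' U) (hUo.preimage (by fun_prop))
    (hUc.translate_preimage_left w) (by simpa using hw) (hmem (a, a') ha') (by simpa using haU)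
    (fun p hp hpU => by simpa using hrel _ hp hpU)
  simpa [hG] using hzero

/-- A monotone multifunction of type (FPV) with nonempty domain is maximally monotone. -/
theorem IsTypeFPV.isMaximallyMonotone {S : Multifunction E} (h : S.IsTypeFPV)
    (hne : S.domain.Nonempty) : S.IsMaximallyMonotone := by
  refine ⟨h.1, fun T hT hST => ?_⟩
  ext x x'
  refine ⟨fun hx => ?_, fun hx => hST (a := (x, x')) hx⟩
  exact h.2 univ isOpen_univ convex_univ (by simpa using hne) x (mem_univ x) x'
    fun p hp _ => hT p (hST hp) (x, x') hx

end Multifunction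

theorem mainTheorem2 {E : Type*} [NormedAddCommGroup E] [NormedSpace ℝ E] [CompleteSpace E]
    (S : Multifunction E) (hclosed : S.Closed) (hmono : S.IsMonotone) (hqd : S.Quasidense) :
    S.IsMaximallyMonotone ∧ S.IsTypeFPV := by
  have hFPV := hqd.isTypeFPV hclosed hmono
  obtain ⟨p, hp, -⟩ := hqd.quasidenseSet 0 0 1 one_pos
  exact ⟨hFPV.isMaximallyMonotone ⟨p.1, p.2, hp⟩, hFPV⟩
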